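/- Let $(X,d)$ be an infinite metric space and let $\mathfrak{B}$ be a bornology on $X$, i.e. a family of subsets of $X$ that is hereditary, closed under finite unions and covers $X$; assume $X\notin\mathfrak{B}$ and that $\mathfrak{B}$ has a closed base (a cofinal subfamily, with respect to inclusion, consisting of closed sets). For $B\subseteq X$ and $\delta>0$ put $B^{\delta}=\bigcup_{x\in B}\{y\in X: d(x,y)<\delta\}$. A cover $\mathcal{U}$ of $X$ is a $\mathfrak{B}^s$-cover if $X\notin\mathcal{U}$ and for each $B\in\mathfrak{B}$ there are $U\in\mathcal{U}$ and $\delta>0$ with $B^{\delta}\subseteq U$; $\mathcal{O}_{\mathfrak{B}^s}$ is the class of all $\mathfrak{B}^s$-covers whose members are open. An infinite open cover $\mathcal{U}=\{U_n:n\in\mathbb{N}\}$ of $X$ belongs to $\Gamma_{\mathfrak{B}^s}$ if for every $B\in\mathfrak{B}$ there are $n_0\in\mathbb{N}$ and $\delta_n>0$ $(n\ge n_0)$ with $B^{\delta_n}\subseteq U_n$ for all $n\ge n_0$. The space $X$ is $\mathfrak{B}^s$-Lindelöf if each $\mathfrak{B}^s$-cover contains a countable subfamily that is a $\mathfrak{B}^s$-cover.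 Let $\tau^s_{\mathfrak{B}}$ be the topology of strong uniform convergence on the set $C(X)$ of continuous functions $X\to\mathbb{R}$: it is the topology induced by the uniformity with base the sets $$[B,\varepsilon]^s=\{(f,g): \exists\,\delta>0\ \forall x\in B^{\delta}\ |f(x)-g(x)|<\varepsilon\},\qquad B\in\mathfrak{B},\ \varepsilon>0 .$$ Let $\underline{0}$ be the zero function. In $(C(X),\tau^s_{\mathfrak{B}})$, let $\Omega_{\underline{0}}$ be the class of all sets $A$ with $\underline{0}\in\overline{A}\setminus A$, and $\Sigma_{\underline{0}}$ the class of all sequences converging to $\underline{0}$ (a sequence being identified with the set of its terms). For classes $\mathcal{A},\mathcal{C}$ of subsets of a set, $S_1(\mathcal{A},\mathcal{C})$ says that for every sequence $(A_n)_{n\in\mathbb{N}}$ in $\mathcal{A}$ there are $b_n\in A_n$ with $\{b_n:n\in\mathbb{N}\}\in\mathcal{C}$; and $\alpha_2(\mathcal{A},\mathcal{C})$, $\alpha_3(\mathcal{A},\mathcal{C})$, $\alpha_4(\mathcal{A},\mathcal{C})$ say that for every sequence $(A_n)_{n\in\mathbb{N}}$ in $\mathcal{A}$ there is $C\in\mathcal{C}$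 such that, respectively, $A_n\cap C$ is infinite for every $n$; $A_n\cap C$ is infinite for infinitely many $n$; $A_n\cap C\neq\emptyset$ for infinitely many $n$. Theorem. If $X$ is $\mathfrak{B}^s$-Lindelöf, then the following statements are equivalent: 1. $(C(X),\tau^s_{\mathfrak{B}})$ satisfies $\alpha_2(\Omega_{\underline{0}},\Sigma_{\underline{0}})$; 2. $(C(X),\tau^s_{\mathfrak{B}})$ satisfies $\alpha_3(\Omega_{\underline{0}},\Sigma_{\underline{0}})$; 3. $(C(X),\tau^s_{\mathfrak{B}})$ satisfies $\alpha_4(\Omega_{\underline{0}},\Sigma_{\underline{0}})$; 4. $X$ satisfies $S_1(\mathcal{O}_{\mathfrak{B}^s},\Gamma_{\mathfrak{B}^s})$. -/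

import Mathlib

open Set Filter Topology

/-! ## Bornologies -/

/-- The members of a bornology on `X`, as a family of subsets of `X`: this family is hereditary,
closed under finite unions, and covers `X`. The bornology is an explicit argument; it is in general
not the bornology of metrically bounded sets. -/
def bornSets {X : Type*} (𝔅 : Bornology X) : Set (Set X) :=
  {B | @Bornology.IsBounded X 𝔅 B}

/-- `𝔅₀` is a base of `𝔅`: a subfamily that is cofinal with respect to inclusion. -/
def IsBornBase {X : Type*} (𝔅 : Bornology X) (𝔅₀ : Set (Set X)) : Prop :=
  𝔅₀ ⊆ bornSets 𝔅 ∧ ∀ B ∈ bornSets 𝔅, ∃ B₀ ∈ 𝔅₀, B ⊆ B₀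

/-- The bornology has a base that consists of closed sets. -/
def HasClosedBase {X : Type*} [MetricSpace X] (𝔅 : Bornology X) : Prop :=
  ∃ 𝔅₀ : Set (Set X), IsBornBase 𝔅 𝔅₀ ∧ ∀ B ∈ 𝔅₀, IsClosed B

/-! ## Bornological covers

The enlargement `B^δ = ⋃ x ∈ B, {y | d(x, y) < δ}` is `Metric.thickening δ B`. -/

/-- Strong `𝔅`-covers (`𝔅ˢ`-covers) of `X`. -/
def IsStrongCover {X : Type*} [MetricSpace X] (𝔅 : Bornology X) (𝒰 : Set (Set X)) : Prop :=
  ⋃₀ 𝒰 = univ ∧ univ ∉ 𝒰 ∧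
    ∀ B ∈ bornSets 𝔅, ∃ U ∈ 𝒰, ∃ δ : ℝ, 0 < δ ∧ Metric.thickening δ B ⊆ U

/-- The class of all open `𝔅ˢ`-covers of `X`. -/
def openStrongCovers {X : Type*} [MetricSpace X] (𝔅 : Bornology X) : Set (Set (Set X)) :=
  {𝒰 | IsStrongCover 𝔅 𝒰 ∧ ∀ U ∈ 𝒰, IsOpen U}

/-- The class of all `γ`-`𝔅ˢ`-covers of `X`: infinite open covers `{U n : n ∈ ℕ}` such that for
every `B ∈ 𝔅`, for all large `n`, some enlargement `B^(δ n)` lies in `U n`. -/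
def gammaStrongCovers {X : Type*} [MetricSpace X] (𝔅 : Bornology X) : Set (Set (Set X)) :=
  {𝒰 | 𝒰.Infinite ∧ ⋃₀ 𝒰 = univ ∧ (∀ U ∈ 𝒰, IsOpen U) ∧
    ∃ U : ℕ → Set X, 𝒰 = range U ∧
      ∀ B ∈ bornSets 𝔅, ∃ n₀ : ℕ, ∃ δ : ℕ → ℝ,
        ∀ n ≥ n₀, 0 < δ n ∧ Metric.thickening (δ n) B ⊆ U n}

/-- `X` is `𝔅ˢ`-Lindelöf: each `𝔅ˢ`-cover contains a countable `𝔅ˢ`-subcover. -/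
def IsStrongLindelof {X : Type*} [MetricSpace X] (𝔅 : Bornology X) : Prop :=
  ∀ 𝒰 : Set (Set X), IsStrongCover 𝔅 𝒰 →
    ∃ 𝒱 : Set (Set X), 𝒱 ⊆ 𝒰 ∧ 𝒱.Countable ∧ IsStrongCover 𝔅 𝒱

/-! ## Selection principles -/

/-- `S₁(𝒜, ℬ)`. -/
def SelOne {S : Type*} (𝒜 ℬ : Set (Set S)) : Prop :=
  ∀ A : ℕ → Set S, (∀ n, A n ∈ 𝒜) → ∃ b : ℕ → S, (∀ n, b n ∈ A n) ∧ range b ∈ ℬ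

/-- `α₂(𝒜, ℬ)`. -/
def AlphaTwo {S : Type*} (𝒜 ℬ : Set (Set S)) : Prop :=
  ∀ A : ℕ → Set S, (∀ n, A n ∈ 𝒜) → ∃ B ∈ ℬ, ∀ n, (A n ∩ B).Infinite

/-- `α₃(𝒜, ℬ)`. -/
def AlphaThree {S : Type*} (𝒜 ℬ : Set (Set S)) : Prop :=
  ∀ A : ℕ → Set S, (∀ n, A n ∈ 𝒜) → ∃ B ∈ ℬ, {n : ℕ | (A n ∩ B).Infinite}.Infinite

/-- `α₄(𝒜, ℬ)`. -/
def AlphaFour {S : Type*} (𝒜 ℬ : Set (Set S)) : Prop :=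
  ∀ A : ℕ → Set S, (∀ n, A n ∈ 𝒜) → ∃ B ∈ ℬ, {n : ℕ | (A n ∩ B).Nonempty}.Infinite

/-- `Ω_x` in the topological space `(E, τ)`: the sets `A` with `x` in the closure of `A`
but not in `A`. -/
def omegaAt {E : Type*} (τ : TopologicalSpace E) (x : E) : Set (Set E) :=
  {A | x ∈ @closure E τ A \ A}

/-- `Σ_x` in the topological space `(E, τ)`: the sequences that converge to `x`, each regarded as
the set of its terms. -/
def sigmaAt {E : Type*} (τ : TopologicalSpace E) (x : E) : Set (Set E) :=
  {A | ∃ s : ℕ → E, A = range s ∧ Tendsto s atTop (@nhds E τ x)}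

/-! ## The topology of strong uniform convergence on a bornology -/

/-- The entourage `[B, ε]ˢ` on `Y^X`. -/
def strongEntourage {X Y : Type*} [MetricSpace X] [MetricSpace Y] (B : Set X) (ε : ℝ) :
    Set ((X → Y) × (X → Y)) :=
  {p | ∃ δ : ℝ, 0 < δ ∧ ∀ x ∈ Metric.thickening δ B, dist (p.1 x) (p.2 x) < ε}

/-- The sets `[B, ε]ˢ` with `B ∈ 𝔅` and `ε > 0` form a filter base. -/
def strongFilterBasis {X : Type*} [MetricSpace X] (𝔅 : Bornology X) (Y : Type*) [MetricSpace Y] :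
    FilterBasis ((X → Y) × (X → Y)) where
  sets := {V | ∃ B ∈ bornSets 𝔅, ∃ ε : ℝ, 0 < ε ∧ V = strongEntourage B ε}
  nonempty := ⟨_, ∅, @Bornology.isBounded_empty X 𝔅, 1, one_pos, rfl⟩
  inter_sets := by
    rintro _ _ ⟨B, hB, ε, hε, rfl⟩ ⟨C, hC, η, hη, rfl⟩
    refine ⟨_, ⟨B ∪ C, @Bornology.IsBounded.union X 𝔅 B C hB hC, min ε η, lt_min hε hη, rfl⟩, ?_⟩
    rintro p ⟨δ, hδ, h⟩
    exact ⟨⟨δ, hδ, fun x hx => (h x (Metric.thickening_subset_of_subset δ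
        subset_union_left hx)).trans_le (min_le_left _ _)⟩,
      ⟨δ, hδ, fun x hx => (h x (Metric.thickening_subset_of_subset δ
        subset_union_right hx)).trans_le (min_le_right _ _)⟩⟩

/-- The uniformity on `Y^X` with base the sets `[B, ε]ˢ`, `B ∈ 𝔅`, `ε > 0`. -/
@[reducible]
def strongUniformSpace {X : Type*} [MetricSpace X] (𝔅 : Bornology X) (Y : Type*) [MetricSpace Y] :
    UniformSpace (X → Y) :=
  UniformSpace.ofCore <| UniformSpace.Core.mkOfBasis (strongFilterBasis 𝔅 Y)
    (by
      rintro _ ⟨B, hB, ε, hε, rfl⟩ f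
      exact ⟨1, one_pos, fun x _ => by simpa using hε⟩)
    (by
      rintro _ ⟨B, hB, ε, hε, rfl⟩
      refine ⟨_, ⟨B, hB, ε, hε, rfl⟩, ?_⟩
      rintro p ⟨δ, hδ, h⟩
      exact ⟨δ, hδ, fun x hx => by simpa [dist_comm] using h x hx⟩)
    (by
      rintro _ ⟨B, hB, ε, hε, rfl⟩
      refine ⟨_, ⟨B, hB, ε / 2, half_pos hε, rfl⟩, ?_⟩
      rintro ⟨f, g⟩ ⟨k, ⟨δ, hδ, h⟩, ⟨η, hη, h'⟩⟩
      refine ⟨min δ η, lt_min hδ hη, fun x hx => ?_⟩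
      have h1 := h x (Metric.thickening_mono (min_le_left _ _) B hx)
      have h2 := h' x (Metric.thickening_mono (min_le_right _ _) B hx)
      have h3 := dist_triangle (f x) (k x) (g x)
      dsimp only at h1 h2 ⊢
      linarith)

/-- The topology `τˢ_𝔅` of strong uniform convergence on `𝔅`, on the set `C(X)` of continuous
real-valued functions on `X`. -/
@[reducible]
def strongTopology {X : Type*} [MetricSpace X] (𝔅 : Bornology X) : TopologicalSpace C(X, ℝ) :=
  TopologicalSpace.induced (fun f : C(X, ℝ) => (f : X → ℝ))
    (strongUniformSpace 𝔅 ℝ).toTopologicalSpace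

/-!
Basic neighbourhoods of `0` are given by `|f| < ε` on an enlargement of a member of `𝔅`, so functions
`f` close to `0` correspond to open sets `{x | |f x| < ε}` that contain an enlargement of a prescribed
`B ∈ 𝔅`. Both nontrivial implications translate between `Ω₀` and open `𝔅ˢ`-covers in this way, and
both replace a sequence of covers by the covers of finite intersections
(`iInter_mem_openStrongCovers`), so that a selection known only along infinitely many indices still
serves all of them.

From `α₄` to `S₁`: the `α₄` property is worthless if a single function lies in infinitely many of the
given sets. The Lindelöf hypothesis makes the covers countable, and removing finitely many members
from a cover leaves a cover (`IsStrongCover.diff_finite`), so the covers `𝒱 n` can be arranged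
such that every open set lies in only finitely many of them (`exists_pointFinite_subcovers`). Then
`{f | {x | f x < 1} ∈ 𝒱 n}` lies in `Ω₀` (`sublevel_mem_omegaAt`), and each function belongs to only
finitely many of these sets because it determines its sublevel set.

From `S₁` to `α₂`: for `A ∈ Ω₀` the sets `{x | |f x| < ε} \ {y}`, `f ∈ A`, form an open `𝔅ˢ`-cover
(`smallSets_mem_openStrongCovers`); removing the point `y` keeps `X` itself out of the cover, which
is harmless because `𝔅` has a closed base and `X ∉ 𝔅`. Along an infinite set of indices on which
the selection is injective, all but finitely many selected sets contain an enlargement of a given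
`B`, and the functions behind them form the sequence.
-/

/-! ### Finite sets and unions -/

section

variable {X : Type*} {𝔅 : Bornology X}

theorem finite_mem_bornSets {F : Set X} (hF : F.Finite) : F ∈ bornSets 𝔅 :=
  @Set.Finite.isBounded X 𝔅 F hF

theorem union_mem_bornSets {B C : Set X} (hB : B ∈ bornSets 𝔅) (hC : C ∈ bornSets 𝔅) :
    B ∪ C ∈ bornSets 𝔅 :=
  @Bornology.IsBounded.union X 𝔅 B C hB hC

theorem exists_finite_not_subset {𝒲 : Set (Set X)} (hf : 𝒲.Finite) (hu : univ ∉ 𝒲) :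
    ∃ F : Set X, F.Finite ∧ ∀ W ∈ 𝒲, ¬ F ⊆ W := by
  have h : ∀ W : Set X, ∃ F : Set X, F.Finite ∧ (W ∈ 𝒲 → ¬ F ⊆ W) := fun W => by
    by_cases hW : W = univ
    · exact ⟨∅, finite_empty, fun h => absurd (hW ▸ h) hu⟩
    · obtain ⟨x, hx⟩ := (ne_univ_iff_exists_notMem W).1 hW
      exact ⟨{x}, finite_singleton x, fun _ hs => hx (hs rfl)⟩
  choose F hF hFW using h
  exact ⟨⋃ W ∈ 𝒲, F W, hf.biUnion fun W _ => hF W,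
    fun W hW hs => hFW W hW ((subset_biUnion_of_mem hW).trans hs)⟩

/-! ### Neighbourhoods of zero -/

variable [MetricSpace X]

theorem hasBasis_nhds_zero (𝔅 : Bornology X) :
    (@nhds C(X, ℝ) (strongTopology 𝔅) 0).HasBasis
      (fun p : Set X × ℝ => p.1 ∈ bornSets 𝔅 ∧ 0 < p.2)
      (fun p => {f | ∃ δ : ℝ, 0 < δ ∧ ∀ x ∈ Metric.thickening δ p.1, |f x| < p.2}) := by
  let : UniformSpace (X → ℝ) := strongUniformSpace 𝔅 ℝ
  have hu : (uniformity (X → ℝ)).HasBasis (fun p : Set X × ℝ => p.1 ∈ bornSets 𝔅 ∧ 0 < p.2)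
      (fun p => strongEntourage p.1 p.2) := by
    refine ⟨fun t => ?_⟩
    refine (strongFilterBasis 𝔅 ℝ).mem_filter_iff.trans ?_
    constructor
    · rintro ⟨_, ⟨B, hB, ε, hε, rfl⟩, h⟩
      exact ⟨(B, ε), ⟨hB, hε⟩, h⟩
    · rintro ⟨⟨B, ε⟩, ⟨hB, hε⟩, h⟩
      exact ⟨_, ⟨B, hB, ε, hε, rfl⟩, h⟩
  rw [@nhds_induced _ _ (strongUniformSpace 𝔅 ℝ).toTopologicalSpace]
  convert (nhds_basis_uniformity hu).comap (fun f : C(X, ℝ) => (f : X → ℝ)) using 2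
  ext f
  simp [strongEntourage, Real.dist_eq]

theorem mem_omegaAt_zero {A : Set C(X, ℝ)} :
    A ∈ omegaAt (strongTopology 𝔅) 0 ↔ 0 ∉ A ∧ ∀ B ∈ bornSets 𝔅, ∀ ε : ℝ, 0 < ε →
      ∃ f ∈ A, ∃ δ : ℝ, 0 < δ ∧ ∀ x ∈ Metric.thickening δ B, |f x| < ε := by
  rw [omegaAt, mem_ofPred_eq, Set.mem_sdiff, and_comm]
  let := strongTopology 𝔅
  rw [mem_closure_iff_nhds_basis (hasBasis_nhds_zero 𝔅), Prod.forall]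
  exact and_congr_right fun _ => ⟨fun h B hB ε hε => h B ε ⟨hB, hε⟩,
    fun h B ε hp => h B hp.1 ε hp.2⟩

theorem tendsto_zero_iff {s : ℕ → C(X, ℝ)} :
    Tendsto s atTop (@nhds C(X, ℝ) (strongTopology 𝔅) 0) ↔
      ∀ B ∈ bornSets 𝔅, ∀ ε : ℝ, 0 < ε →
        ∀ᶠ m in atTop, ∃ δ : ℝ, 0 < δ ∧ ∀ x ∈ Metric.thickening δ B, |s m x| < ε := by
  rw [(hasBasis_nhds_zero 𝔅).tendsto_right_iff, Prod.forall]
  exact ⟨fun h B hB ε hε => h B ε ⟨hB, hε⟩, fun h B ε hp => h B hp.1 ε hp.2⟩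

/-- A countably infinite set converges to `0`, in any enumeration without repetitions, as soon as
every basic neighbourhood of `0` contains all but finitely many of its elements. -/
theorem mem_sigmaAt_zero {C : Set C(X, ℝ)} (hc : C.Countable) (hinf : C.Infinite)
    (h : ∀ B ∈ bornSets 𝔅, ∀ ε : ℝ, 0 < ε →
      {f ∈ C | ¬ ∃ δ : ℝ, 0 < δ ∧ ∀ x ∈ Metric.thickening δ B, |f x| < ε}.Finite) :
    C ∈ sigmaAt (strongTopology 𝔅) 0 := by
  have := hc.to_subtype
  have := hinf.to_subtype
  obtain ⟨e⟩ := nonempty_equiv_of_countable (α := ℕ) (β := C)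
  have hinj : Function.Injective (fun n => (e n : C(X, ℝ))) :=
    Subtype.val_injective.comp e.injective
  refine ⟨fun n => e n, ?_, tendsto_zero_iff.2 fun B hB ε hε => ?_⟩
  · ext f
    exact ⟨fun hf => ⟨e.symm ⟨f, hf⟩, by simp⟩, by rintro ⟨n, rfl⟩; exact (e n).2⟩
  · rw [← Nat.cofinite_eq_atTop, eventually_cofinite]
    exact ((h B hB ε hε).preimage hinj.injOn).subset fun n hn => ⟨(e n).2, hn⟩

/-! ### Operations on covers -/

/-- The covering condition follows from the condition on enlargements, as points belong to `𝔅`. -/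
theorem isStrongCover_iff {𝒰 : Set (Set X)} :
    IsStrongCover 𝔅 𝒰 ↔ univ ∉ 𝒰 ∧
      ∀ B ∈ bornSets 𝔅, ∃ U ∈ 𝒰, ∃ δ : ℝ, 0 < δ ∧ Metric.thickening δ B ⊆ U := by
  refine ⟨fun h => h.2, fun h => ⟨eq_univ_of_forall fun x => ?_, h⟩⟩
  obtain ⟨U, hU, δ, hδ, hs⟩ := h.2 {x} (finite_mem_bornSets (finite_singleton x))
  exact ⟨U, hU, hs (Metric.self_subset_thickening hδ _ rfl)⟩

theorem exists_common_enlargement {B : Set X} (U : ℕ → Set X)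
    (h : ∀ i, ∃ δ : ℝ, 0 < δ ∧ Metric.thickening δ B ⊆ U i) (n : ℕ) :
    ∃ δ : ℝ, 0 < δ ∧ Metric.thickening δ B ⊆ ⋂ i ∈ Iic n, U i := by
  choose δ hδ hs using h
  have hne : (Finset.Iic n).Nonempty := ⟨n, by simp⟩
  refine ⟨(Finset.Iic n).inf' hne δ, by simpa [Finset.lt_inf'_iff] using fun i _ => hδ i, ?_⟩
  refine subset_iInter₂ fun i hi => (Metric.thickening_mono ?_ B).trans (hs i)
  exact Finset.inf'_le _ (by simpa using hi)

/-- The refining sets are intersected over `0, …, n`, so one set of the `n`-th refinement yields a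
member of each of the covers `𝒰 0, …, 𝒰 n`. -/
theorem iInter_mem_openStrongCovers {𝒰 : ℕ → Set (Set X)}
    (h : ∀ i, 𝒰 i ∈ openStrongCovers 𝔅) (n : ℕ) :
    {W | ∃ U : ℕ → Set X, (∀ i, U i ∈ 𝒰 i) ∧ W = ⋂ i ∈ Iic n, U i} ∈ openStrongCovers 𝔅 := by
  refine ⟨isStrongCover_iff.2 ⟨?_, fun B hB => ?_⟩, ?_⟩
  · rintro ⟨U, hU, hW⟩
    have : U 0 = univ := univ_subset_iff.1 (hW.subset.trans (iInter₂_subset 0 (Nat.zero_le n)))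
    exact (h 0).1.2.1 (this ▸ hU 0)
  · choose U hU hB using fun i => (h i).1.2.2 B hB
    exact ⟨_, ⟨U, hU, rfl⟩, exists_common_enlargement U hB n⟩
  · rintro _ ⟨U, hU, rfl⟩
    exact (finite_Iic n).isOpen_biInter fun i _ => (h i).2 _ (hU i)

/-- To cover `B` while avoiding the finitely many removed sets, cover `B` together with a point
outside each of them. -/
theorem IsStrongCover.diff_finite {𝒰 𝒲 : Set (Set X)} (h : IsStrongCover 𝔅 𝒰)
    (hf : 𝒲.Finite) : IsStrongCover 𝔅 (𝒰 \ 𝒲) := by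
  refine isStrongCover_iff.2 ⟨fun hu => h.2.1 hu.1, fun B hB => ?_⟩
  obtain ⟨F, hF, hFW⟩ := exists_finite_not_subset (hf.inter_of_right 𝒰) fun hu => h.2.1 hu.1
  obtain ⟨U, hU, δ, hδ, hs⟩ := h.2.2 _ (union_mem_bornSets hB (finite_mem_bornSets hF))
  refine ⟨U, ⟨hU, fun hW => hFW U ⟨hU, hW⟩ ?_⟩, δ, hδ, ?_⟩
  · exact subset_union_right.trans ((Metric.self_subset_thickening hδ _).trans hs)
  · exact (Metric.thickening_subset_of_subset δ subset_union_left).trans hs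

theorem exists_pointFinite_subcovers (hL : IsStrongLindelof 𝔅) {𝒰 : ℕ → Set (Set X)}
    (h : ∀ n, 𝒰 n ∈ openStrongCovers 𝔅) :
    ∃ 𝒱 : ℕ → Set (Set X), (∀ n, 𝒱 n ⊆ 𝒰 n) ∧ (∀ n, 𝒱 n ∈ openStrongCovers 𝔅) ∧
      ∀ V, {n | V ∈ 𝒱 n}.Finite := by
  choose 𝒞 hsub hc hcov using fun n => hL (𝒰 n) (h n).1
  obtain ⟨e, he⟩ := countable_iff_exists_subset_range.1 (countable_iUnion hc)
  -- The set `e k` can survive only in the covers with index at most `k`.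
  refine ⟨fun n => 𝒞 n \ e '' Iio n, fun n => sdiff_subset.trans (hsub n), fun n =>
    ⟨(hcov n).diff_finite ((finite_Iio n).image e), fun V hV => (h n).2 V (hsub n hV.1)⟩,
    fun V => ?_⟩
  by_cases hV : V ∈ ⋃ n, 𝒞 n
  · obtain ⟨k, rfl⟩ := he hV
    exact (finite_Iic k).subset fun n hn => mem_Iic.2 <| not_lt.1 fun hk => hn.2 ⟨k, hk, rfl⟩
  · exact finite_empty.subset fun n hn => hV (mem_iUnion.2 ⟨n, hn.1⟩)

/-- A sequence of open sets different from `X` that eventually contain enlargements of each member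
of `𝔅` has infinite range, because a finite range would miss a fixed finite set. -/
theorem range_mem_gammaStrongCovers {b : ℕ → Set X} (ho : ∀ n, IsOpen (b n))
    (hu : ∀ n, b n ≠ univ)
    (h : ∀ B ∈ bornSets 𝔅, ∀ᶠ n in atTop, ∃ δ : ℝ, 0 < δ ∧ Metric.thickening δ B ⊆ b n) :
    range b ∈ gammaStrongCovers 𝔅 := by
  refine ⟨fun hfin => ?_, eq_univ_of_forall fun x => ?_, by rintro _ ⟨n, rfl⟩; exact ho n,
    b, rfl, fun B hB => ?_⟩
  · obtain ⟨F, hF, hFb⟩ := exists_finite_not_subset hfin (by rintro ⟨n, hn⟩; exact hu n hn)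
    obtain ⟨n, δ, hδ, hs⟩ := (h F (finite_mem_bornSets hF)).exists
    exact hFb _ ⟨n, rfl⟩ ((Metric.self_subset_thickening hδ _).trans hs)
  · obtain ⟨n, δ, hδ, hs⟩ := (h {x} (finite_mem_bornSets (finite_singleton x))).exists
    exact ⟨b n, ⟨n, rfl⟩, hs (Metric.self_subset_thickening hδ _ rfl)⟩
  · obtain ⟨n₀, hn₀⟩ := eventually_atTop.1 (h B hB)
    choose! δ hδ using hn₀
    exact ⟨n₀, δ, hδ⟩

/-- A property of the family alone, so it may be used with an enumeration other than the one that
witnesses the `γ`-property, for instance that of a selection. -/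
theorem finite_not_enlargement_of_mem_gamma {𝒰 : Set (Set X)} (h : 𝒰 ∈ gammaStrongCovers 𝔅)
    {B : Set X} (hB : B ∈ bornSets 𝔅) :
    {U ∈ 𝒰 | ¬ ∃ δ : ℝ, 0 < δ ∧ Metric.thickening δ B ⊆ U}.Finite := by
  obtain ⟨-, -, -, U, rfl, hU⟩ := h
  obtain ⟨n₀, δ, hδ⟩ := hU B hB
  refine ((finite_Iio n₀).image U).subset ?_
  rintro _ ⟨⟨n, rfl⟩, hn⟩
  exact ⟨n, not_le.1 fun hle => hn ⟨δ n, hδ n hle⟩, rfl⟩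

/-! ### From functions to covers -/

/-- If a positive enlargement of `B` lies in the open set `V ≠ X`, some continuous function vanishes
on an enlargement of `B` and has `V` as its sublevel set at height `1`. -/
theorem exists_continuousMap_sublevel_eq {B V : Set X} (hV : IsOpen V)
    (hne : V ≠ univ) {δ : ℝ} (hδ : 0 < δ) (hB : Metric.thickening δ B ⊆ V) :
    ∃ f : C(X, ℝ), {x | f x < 1} = V ∧
      ∃ η : ℝ, 0 < η ∧ ∀ x ∈ Metric.thickening η B, f x = 0 := by
  rcases B.eq_empty_or_nonempty with rfl | hBne
  -- The general formula fails here, since `Metric.infDist x ∅ = 0`.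
  · have hVc : Vᶜ.Nonempty := nonempty_compl.2 hne
    refine ⟨⟨fun x => 1 - Metric.infDist x Vᶜ, by fun_prop⟩, ?_, 1, one_pos, by simp⟩
    ext x
    simp [← hV.isClosed_compl.notMem_iff_infDist_pos hVc]
  have hVc : Vᶜ.Nonempty := nonempty_compl.2 hne
  set T := Metric.thickening (δ / 2) B
  have hTne : T.Nonempty := hBne.mono (Metric.self_subset_thickening (half_pos hδ) B)
  have hg : ∀ x, 0 < Metric.infDist x Vᶜ ↔ x ∈ V := fun x => by
    simp [← hV.isClosed_compl.notMem_iff_infDist_pos hVc]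
  -- A point outside `V` has distance at least `δ / 2` from `T`.
  have hh : ∀ x ∉ V, 0 < Metric.infDist x T := fun x hx => by
    refine (half_pos hδ).trans_le ((Metric.le_infDist hTne).2 fun y hy => ?_)
    by_contra! hlt
    obtain ⟨z, hz, hyz⟩ := Metric.mem_thickening_iff.1 hy
    exact hx (hB (Metric.mem_thickening_iff.2
      ⟨z, hz, by linarith [dist_triangle x y z]⟩))
  have hpos : ∀ x, 0 < Metric.infDist x Vᶜ + Metric.infDist x T := fun x => by
    by_cases hx : x ∈ V
    · exact add_pos_of_pos_of_nonneg ((hg x).2 hx) Metric.infDist_nonneg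
    · exact add_pos_of_nonneg_of_pos Metric.infDist_nonneg (hh x hx)
  refine ⟨⟨fun x => Metric.infDist x T / (Metric.infDist x Vᶜ + Metric.infDist x T),
    Continuous.div (by fun_prop) (by fun_prop) fun x => (hpos x).ne'⟩, ?_, δ / 2, half_pos hδ,
    fun x hx => ?_⟩
  · ext x
    simp [div_lt_one (hpos x), hg]
  · simp [Metric.infDist_zero_of_mem (show x ∈ T from hx)]

/-- The functions are recorded by their sublevel sets at height `1`, so that one function cannot
stand for two different members of the cover. -/
theorem sublevel_mem_omegaAt {𝒱 : Set (Set X)} (h : 𝒱 ∈ openStrongCovers 𝔅) :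
    {f : C(X, ℝ) | {x | f x < 1} ∈ 𝒱} ∈ omegaAt (strongTopology 𝔅) 0 := by
  refine mem_omegaAt_zero.2 ⟨fun h0 => h.1.2.1 (by simpa using h0), fun B hB ε hε => ?_⟩
  obtain ⟨V, hV, δ, hδ, hs⟩ := h.1.2.2 B hB
  obtain ⟨f, hf, η, hη, h0⟩ := exists_continuousMap_sublevel_eq (h.2 V hV)
    (fun hu => h.1.2.1 (hu ▸ hV)) hδ hs
  exact ⟨f, by simpa [hf] using hV, η, hη, fun x hx => by simpa [h0 x hx] using hε⟩

theorem selOne_of_alphaFour (hL : IsStrongLindelof 𝔅)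
    (h : AlphaFour (omegaAt (strongTopology 𝔅) 0) (sigmaAt (strongTopology 𝔅) 0)) :
    SelOne (openStrongCovers 𝔅) (gammaStrongCovers 𝔅) := by
  intro 𝒰 h𝒰
  obtain ⟨𝒱, hsub, h𝒱, hfin⟩ :=
    exists_pointFinite_subcovers hL fun n => iInter_mem_openStrongCovers h𝒰 n
  obtain ⟨_, ⟨s, rfl, hs⟩, hinf⟩ := h _ fun n => sublevel_mem_omegaAt (h𝒱 n)
  have hN : ∀ i, ∃ n, i ≤ n ∧ ∃ m, {x | s m x < 1} ∈ 𝒱 n := fun i => by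
    obtain ⟨n, ⟨_, hf, m, rfl⟩, hn⟩ := hinf.exists_gt i
    exact ⟨n, hn.le, m, hf⟩
  -- Each `i` uses an index `n i ≥ i`; the set found there refines a member of `𝒰 i`.
  choose n hin m hm using hN
  choose U hU hW using fun i => hsub _ (hm i)
  -- Since `n i → ∞` and each set lies in finitely many covers, `m` is finite-to-one.
  have hn : Tendsto n atTop atTop := tendsto_atTop_mono hin tendsto_id
  have hmt : Tendsto m atTop atTop := by
    simp only [← Nat.cofinite_eq_atTop] at hn ⊢
    refine Tendsto.cofinite_of_finite_preimage_singleton fun k => ?_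
    have : (n ⁻¹' {j | {x | s k x < 1} ∈ 𝒱 j}).Finite := by
      have h1 := hn (hfin {x | s k x < 1}).compl_mem_cofinite
      simpa using h1
    exact this.subset fun i hi => by
      have hi : m i = k := hi
      exact hi ▸ hm i
  refine ⟨fun i => U i i, fun i => hU i i, range_mem_gammaStrongCovers
    (fun i => (h𝒰 i).2 _ (hU i i)) (fun i hu => (h𝒰 i).1.2.1 (hu ▸ hU i i)) fun B hB => ?_⟩
  filter_upwards [hmt.eventually (tendsto_zero_iff.1 hs B hB 1 one_pos)]
  rintro i ⟨δ, hδ, hlt⟩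
  refine ⟨δ, hδ, fun x hx => ?_⟩
  have : x ∈ {x | s (m i) x < 1} := (le_abs_self _).trans_lt (hlt x hx)
  rw [hW i] at this
  exact mem_iInter₂.1 this i (hin i)

/-! ### From covers to functions -/

theorem exists_enlargement_subset_compl_singleton (hproper : univ ∉ bornSets 𝔅)
    (hbase : HasClosedBase 𝔅) {B : Set X} (hB : B ∈ bornSets 𝔅) :
    ∃ y : X, ∃ δ : ℝ, 0 < δ ∧ Metric.thickening δ B ⊆ {y}ᶜ := by
  obtain ⟨𝔅₀, ⟨hsub, hcof⟩, hcl⟩ := hbase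
  obtain ⟨C, hC, hBC⟩ := hcof B hB
  obtain ⟨y, hy⟩ := (ne_univ_iff_exists_notMem C).1 fun h => hproper (h ▸ hsub hC)
  obtain ⟨δ, hδ, hball⟩ := Metric.isOpen_iff.1 (hcl C hC).isOpen_compl y hy
  refine ⟨y, δ, hδ, fun x hx hxy => ?_⟩
  obtain rfl : x = y := hxy
  obtain ⟨z, hz, hxz⟩ := Metric.mem_thickening_iff.1 hx
  exact hball (by rwa [Metric.mem_ball, dist_comm]) (hBC hz)

theorem smallSets_mem_openStrongCovers (hproper : univ ∉ bornSets 𝔅) (hbase : HasClosedBase 𝔅)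
    {A : Set C(X, ℝ)} (hA : A ∈ omegaAt (strongTopology 𝔅) 0) {ε : ℝ} (hε : 0 < ε) :
    {U | ∃ f ∈ A, ∃ y : X, U = {x | |f x| < ε} \ {y}} ∈ openStrongCovers 𝔅 := by
  refine ⟨isStrongCover_iff.2 ⟨?_, fun B hB => ?_⟩, ?_⟩
  · rintro ⟨f, -, y, hy⟩
    exact (hy.subset (mem_univ y)).2 rfl
  · obtain ⟨f, hf, δ, hδ, hs⟩ := (mem_omegaAt_zero.1 hA).2 B hB ε hε
    obtain ⟨y, η, hη, hy⟩ := exists_enlargement_subset_compl_singleton hproper hbase hB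
    exact ⟨_, ⟨f, hf, y, rfl⟩, min δ η, lt_min hδ hη, fun x hx =>
      ⟨hs x (Metric.thickening_mono (min_le_left _ _) B hx),
        hy (Metric.thickening_mono (min_le_right _ _) B hx)⟩⟩
  · rintro _ ⟨f, -, y, rfl⟩
    exact (isOpen_lt (by fun_prop) continuous_const).sdiff isClosed_singleton

theorem alphaTwo_of_selOne (hproper : univ ∉ bornSets 𝔅) (hbase : HasClosedBase 𝔅)
    (h : SelOne (openStrongCovers 𝔅) (gammaStrongCovers 𝔅)) :
    AlphaTwo (omegaAt (strongTopology 𝔅) 0) (sigmaAt (strongTopology 𝔅) 0) := by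
  intro A hA
  obtain ⟨b, hb, hΓ⟩ := h _ fun n => iInter_mem_openStrongCovers (fun i =>
    smallSets_mem_openStrongCovers hproper hbase (hA i) (Nat.one_div_pos_of_nat (n := n))) n
  choose U hU hbU using hb
  choose f hf y hfy using hU
  have hbf : ∀ n, ∀ i ≤ n, ∀ x ∈ b n, |f n i x| < 1 / ((n : ℝ) + 1) := fun n i hi x hx => by
    rw [hbU n] at hx
    have := mem_iInter₂.1 hx i hi
    rw [hfy n i] at this
    exact this.1
  -- The selection may repeat a set infinitely often, so only indices in `N` are used.
  obtain ⟨N, -, hN⟩ := exists_subset_bijOn univ b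
  rw [image_univ] at hN
  have hNinf : N.Infinite := fun hfin => hΓ.1 (hN.image_eq ▸ hfin.image b)
  have hbad : ∀ B ∈ bornSets 𝔅, ∀ ε : ℝ, 0 < ε → {n ∈ N | ¬ ∀ i ≤ n, ∃ δ : ℝ, 0 < δ ∧
      ∀ x ∈ Metric.thickening δ B, |f n i x| < ε}.Finite := fun B hB ε hε => by
    obtain ⟨k, hk⟩ := exists_nat_one_div_lt hε
    have h1 : {n ∈ N | ¬ ∃ δ : ℝ, 0 < δ ∧ Metric.thickening δ B ⊆ b n}.Finite :=
      Set.Finite.of_finite_image ((finite_not_enlargement_of_mem_gamma hΓ hB).subset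
        (by rintro _ ⟨n, hn, rfl⟩; exact ⟨⟨n, rfl⟩, hn.2⟩)) (hN.injOn.mono fun n hn => hn.1)
    refine (h1.union (finite_Iio k)).subset fun n hn => ?_
    by_contra hcon
    simp only [mem_union, mem_ofPred_eq, not_or, mem_Iio, not_and, not_not, not_lt] at hcon
    obtain ⟨δ, hδ, hs⟩ := hcon.1 hn.1
    refine hn.2 fun i hi => ⟨δ, hδ, fun x hx => (hbf n i hi x (hs hx)).trans (lt_of_le_of_lt ?_ hk)⟩
    exact Nat.one_div_le_one_div hcon.2
  set C : Set C(X, ℝ) := ⋃ n ∈ N, (f n) '' Iic n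
  -- A fixed function `g = f n i` is nonzero at some point, so it recurs only finitely often.
  have hAC : ∀ i, (A i ∩ C).Infinite := fun i hfin => by
    refine (hNinf.sdiff (finite_Iio i)) (Set.Finite.of_finite_fibers (fun n => f n i)
      (hfin.subset ?_) ?_)
    · rintro _ ⟨n, hn, rfl⟩
      exact ⟨hf n i, mem_biUnion hn.1 ⟨i, mem_Iic.2 (not_lt.1 hn.2), rfl⟩⟩
    · rintro _ ⟨k, -, rfl⟩
      have hne : f k i ≠ 0 := fun h0 => (hA i).2 (h0 ▸ hf k i)
      obtain ⟨x, hx⟩ := DFunLike.ne_iff.1 hne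
      refine (hbad {x} (finite_mem_bornSets (finite_singleton x)) |f k i x|
        (abs_pos.2 hx)).subset ?_
      rintro n ⟨⟨hn, hin⟩, hnk⟩
      refine ⟨hn, fun hall => ?_⟩
      obtain ⟨δ, hδ, hlt⟩ := hall i (not_lt.1 hin)
      have := hlt x (Metric.self_subset_thickening hδ _ rfl)
      rw [show f n i = f k i from hnk] at this
      exact this.false
  refine ⟨C, mem_sigmaAt_zero (N.to_countable.biUnion fun n _ => ((finite_Iic n).image _).countable)
    ((hAC 0).mono inter_subset_right) fun B hB ε hε => ?_, hAC⟩
  refine ((hbad B hB ε hε).biUnion fun n _ => (finite_Iic n).image (f n)).subset ?_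
  rintro g ⟨hg, hgB⟩
  obtain ⟨n, hn, i, hi, rfl⟩ := mem_iUnion₂.1 hg
  exact mem_biUnion (show n ∈ {n ∈ N | _} from ⟨hn, fun hall => hgB (hall i hi)⟩) ⟨i, hi, rfl⟩

end

/-! ### The equivalence -/

theorem mainTheorem10 {X : Type*} [MetricSpace X] [Infinite X] (𝔅 : Bornology X)
    (hproper : univ ∉ bornSets 𝔅) (hbase : HasClosedBase 𝔅) (hLind : IsStrongLindelof 𝔅) :
    List.TFAE [
      AlphaTwo (omegaAt (strongTopology 𝔅) 0) (sigmaAt (strongTopology 𝔅) 0),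
      AlphaThree (omegaAt (strongTopology 𝔅) 0) (sigmaAt (strongTopology 𝔅) 0),
      AlphaFour (omegaAt (strongTopology 𝔅) 0) (sigmaAt (strongTopology 𝔅) 0),
      SelOne (openStrongCovers 𝔅) (gammaStrongCovers 𝔅)] := by
  tfae_have 1 → 2 := fun h A hA => by
    obtain ⟨C, hC, hAC⟩ := h A hA
    exact ⟨C, hC, by simpa [hAC] using infinite_univ⟩
  tfae_have 2 → 3 := fun h A hA => by
    obtain ⟨C, hC, hAC⟩ := h A hA
    exact ⟨C, hC, hAC.mono fun n hn => hn.nonempty⟩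
  tfae_have 3 → 4 := selOne_of_alphaFour hLind
  tfae_have 4 → 1 := alphaTwo_of_selOne hproper hbase
  tfae_finish
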